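/- Let $0<\alpha\le 1$, $p\in\{1,\dots,6\}$, $q\in\{1,2\}$, $\tau>0$, and let $\lambda,\rho,\kappa\in\mathbb{C}$ with $\lambda+\rho\neq 0$. Let $\omega(p,\alpha,\tau,z)$ be one of the two generating functions $$\omega(p,\alpha,\tau,z)=\Big(\frac1\tau\sum_{k=1}^p\frac1k(1-z)^k\Big)^{\alpha}\qquad\text{(FBDF)}$$ or $$\omega(p,\alpha,\tau,z)=\Big(\frac{1-z}{\tau}\Big)^{\alpha}\sum_{k=1}^p g^{(\alpha)}_{k-1}(1-z)^{k-1}\qquad\text{(GNGF)},$$ where powers are principal values and $g_0^{(\alpha)}=1$, $g_1^{(\alpha)}=\frac{\alpha}{2}$, $g_2^{(\alpha)}=\frac{\alpha^2}{8}+\frac{5\alpha}{24}$, $g_3^{(\alpha)}=\frac{\alpha^3}{48}+\frac{5\alpha^2}{48}+\frac{\alpha}{8}$, $g_4^{(\alpha)}=\frac{\alpha^4}{384}+\frac{5\alpha^3}{192}+\frac{97\alpha^2}{1152}+\frac{251\alpha}{2880}$, $g_5^{(\alpha)}=\frac{\alpha^5}{3840}+\frac{5\alpha^4}{1152}+\frac{61\alpha^3}{2304}+\frac{401\alpha^2}{5760}+\frac{19\alpha}{288}$.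 Let the weights $\omega^{(\alpha)}_n$ be the Taylor coefficients at $0$ of $\omega(p,\alpha,1,z)=\sum_{n\ge0}\omega^{(\alpha)}_nz^n$. Consider the semi-implicit scheme without correction terms with stepsize $\tau$ for the linear test problem ${}_{C}D^{\alpha}_{0,t}u=(\lambda+\rho)u$, $$\frac{1}{\tau^{\alpha}}\sum_{j=0}^{n}\omega^{(\alpha)}_{n-j}(U_j-U_0)=(\lambda+\rho)U_n-(\rho+\kappa)E_q^n(U),\qquad n\ge q,$$ where $E_1^n(U)=U_n-U_{n-1}$ and $E_2^n(U)=U_n-2U_{n-1}+U_{n-2}$, with arbitrary starting values $U_0$ (if $q=1$) or $U_0,U_1$ (if $q=2$) in $\mathbb{C}$. Put $$\mathbb{S}=\mathbb{C}\setminus\Big\{\xi\in\mathbb{C}\ :\ \xi^{\alpha}=\frac{\omega(p,\alpha,1,z)}{(\lambda+\rho)-(\rho+\kappa)(1-z)^q}\ \text{ for some } |z|\le 1 \text{ at which the denominator is nonzero}\Big\}.$$ If $\tau\in\mathbb{S}$, then the scheme is stable: every solution $(U_n)_{n\ge0}$ of it satisfies $U_n\to0$ as $n\to\infty$. -/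

import Mathlib

open Filter Topology

noncomputable section

namespace SemiImplicit

/-- The two families of generating functions: the fractional backward difference formula and the
generalized Newton--Gregory formula. -/
inductive Family
  | fbdf
  | gngf

/-- The Newton--Gregory coefficients `g_k^{(α)}`; they are only used for `k ≤ 5`. -/
def newtonGregory (α : ℝ) : ℕ → ℝ
  | 0 => 1
  | 1 => α / 2
  | 2 => α ^ 2 / 8 + 5 * α / 24
  | 3 => α ^ 3 / 48 + 5 * α ^ 2 / 48 + α / 8
  | 4 => α ^ 4 / 384 + 5 * α ^ 3 / 192 + 97 * α ^ 2 / 1152 + 251 * α / 2880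
  | 5 => α ^ 5 / 3840 + 5 * α ^ 4 / 1152 + 61 * α ^ 3 / 2304 + 401 * α ^ 2 / 5760 + 19 * α / 288
  | _ => 0

/-- The generating function `ω(p, α, τ, z)`; complex powers are principal values. -/
def genFun : Family → ℕ → ℝ → ℝ → ℂ → ℂ
  | .fbdf, p, α, τ, z =>
      ((1 / (τ : ℂ)) * ∑ k ∈ Finset.Icc 1 p, (1 / (k : ℂ)) * (1 - z) ^ k) ^ (α : ℂ)
  | .gngf, p, α, τ, z =>
      ((1 - z) / (τ : ℂ)) ^ (α : ℂ) *
        ∑ k ∈ Finset.Icc 1 p, (newtonGregory α (k - 1) : ℂ) * (1 - z) ^ (k - 1)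

/-- The weights `ω_n^{(α)}`: the coefficients of the power series at `0` of `ω(p, α, 1, z)`. -/
def weight (F : Family) (p : ℕ) (α : ℝ) (n : ℕ) : ℂ :=
  iteratedDeriv n (genFun F p α 1) 0 / (n.factorial : ℂ)

/-- The perturbation `E_q^n(U)`, considered for `q = 1, 2` and `n ≥ q` only. -/
def perturbation (q n : ℕ) (U : ℕ → ℂ) : ℂ :=
  match q with
  | 1 => U n - U (n - 1)
  | 2 => U n - 2 * U (n - 1) + U (n - 2)
  | _ => 0

/-- `U` is a numerical solution of the semi-implicit scheme without correction terms, with stepsize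
`τ`, for the linear test problem with right-hand side `(lam + ρ) u`: the scheme holds at every level
`n ≥ q`; the starting values `U_0, …, U_{q-1}` are arbitrary. -/
def IsSchemeSolution (F : Family) (p q : ℕ) (α τ : ℝ) (lam ρ κ : ℂ) (U : ℕ → ℂ) : Prop :=
  ∀ n : ℕ, q ≤ n →
    (1 / (τ : ℂ) ^ (α : ℂ)) * ∑ j ∈ Finset.range (n + 1), weight F p α (n - j) * (U j - U 0) =
      (lam + ρ) * U n - (ρ + κ) * perturbation q n U

/-- The scheme is stable: every numerical solution tends to `0`. -/
def IsStable (F : Family) (p q : ℕ) (α τ : ℝ) (lam ρ κ : ℂ) : Prop :=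
  ∀ U : ℕ → ℂ, IsSchemeSolution F p q α τ lam ρ κ U → Tendsto U atTop (𝓝 0)

/-- The set `𝕊`: the complement of the set of all `ξ` such that
`ξ ^ α = ω(p, α, 1, z) / ((lam + ρ) - (ρ + κ) (1 - z) ^ q)` for some `z` in the closed unit disc
(at which the quotient is defined). -/
def stabilitySet (F : Family) (p q : ℕ) (α : ℝ) (lam ρ κ : ℂ) : Set ℂ :=
  {ξ : ℂ | ∃ z : ℂ, ‖z‖ ≤ 1 ∧ (lam + ρ) - (ρ + κ) * (1 - z) ^ q ≠ 0 ∧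
    ξ ^ (α : ℂ) = genFun F p α 1 z / ((lam + ρ) - (ρ + κ) * (1 - z) ^ q)}ᶜ

end SemiImplicit

end

/-!
Multiplied by `z ^ n` and summed, the scheme says `(ω(z) - τ ^ α D(z)) U(z) = R(z)`, where
`D(z) = (lam + ρ) - (ρ + κ) (1 - z) ^ q`, and where `R` differs from `U 0 * ω(z) / (1 - z)` by a
polynomial. The coefficients of `ω(z) / (1 - z)` are the partial sums of the series of the weights
at `z = 1`, and tend to `ω(1) = 0`. So the scheme is a causal convolution equation with a null
sequence on the right, and its solution tends to zero because of two facts.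

* The weights are absolutely summable and `ω` is their power series on the closed unit disc
  (`SemiImplicit.isWiener_genFun`, `IsWiener.taylor`). This rests on the binomial series of
  `(1 - c z) ^ α` with `‖c‖ ≤ 1` and `0 < α ≤ 1`. For the backward difference formulas the
  polynomial `∑ (1 - z) ^ k / k` is split into linear factors; its principal power is, up to a
  constant, the product of the powers of the factors, because the polynomial omits the negative
  real axis on the disc (`isWiener_polynomial_cpow`).
* The symbol `ω - τ ^ α D` has no zero in the closed unit disc. Where `D ≠ 0` this is the hypothesis
  on `τ`. Where `D = 0` it says `ω ≠ 0`, which holds away from `z = 1`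
  (`SemiImplicit.genFun_ne_zero`), and `D(1) = lam + ρ ≠ 0`. By Wiener's lemma, obtained here from
  Gelfand theory in the closed algebra generated by the shift, the convolution is then invertible on
  null sequences (`tendsto_zero_of_convolution`).

Both the omission of the negative real axis and the absence of zeros of `ω` are statements on
polynomials in `1 - z` with one real parameter, `x ≥ 0` or `0 < α ≤ 1`. The Möbius map
`s = 2 / (1 - z) - 1` turns the disc into the right half-plane, where the Routh criterion applies
(`sum_one_sub_pow_ne_zero`): the entries of the array are polynomials in the parameter, visibly
positive up to a few small terms.
-/

open scoped ZeroAtInfty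

/-! ### Zero-free discs by the Routh array -/

/-- The relation kept along a Routh array: `f` and `g` do not both vanish, and the quotient `f / g`
lies in the closed right half-plane if `g ≠ 0`. -/
def RightPair (f g : ℂ) : Prop :=
  0 ≤ (f * (starRingEnd ℂ) g).re ∧ ¬(f = 0 ∧ g = 0)

theorem RightPair.add_ne_zero {f g : ℂ} (h : RightPair f g) : f + g ≠ 0 := by
  intro h0
  obtain rfl : f = -g := eq_neg_of_add_eq_zero_left h0
  obtain ⟨h1, h2⟩ := h
  have h3 : (-g * (starRingEnd ℂ) g).re = -(Complex.normSq g) := by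
    rw [neg_mul, Complex.mul_conj, Complex.neg_re, Complex.ofReal_re]
  rw [h3] at h1
  have h4 : g = 0 := Complex.normSq_eq_zero.1 (le_antisymm (by linarith) (Complex.normSq_nonneg g))
  exact h2 ⟨by simp [h4], h4⟩

/-- One step up a Routh array: the quotient `f / g` is a nonnegative multiple of `s` plus a positive
multiple of `1 / (g / e)`. -/
theorem RightPair.step {f g e s : ℂ} {a b : ℝ} (ha : 0 < a) (hb : 0 ≤ b) (hs : 0 ≤ s.re)
    (h : (a : ℂ) * f = b * s * g + e) (hge : RightPair g e) : RightPair f g := by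
  obtain ⟨h1, h2⟩ := hge
  have key : a * (f * (starRingEnd ℂ) g).re =
      b * s.re * Complex.normSq g + (g * (starRingEnd ℂ) e).re := by
    have he : e = a * f - b * s * g := by rw [h]; ring
    rw [he]
    simp [Complex.normSq_apply]
    ring
  refine ⟨?_, ?_⟩
  · have h3 : 0 ≤ b * s.re * Complex.normSq g :=
      mul_nonneg (mul_nonneg hb hs) (Complex.normSq_nonneg g)
    nlinarith
  · rintro ⟨rfl, rfl⟩
    refine h2 ⟨rfl, ?_⟩
    simpa using h.symm

/-- The **Routh criterion** in degree five or six. The numbers `b₁, b₂, c₁, c₂, d₁, e₁` are the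
entries of the fraction-free Routh array. The leading coefficient `a₀` may vanish. -/
theorem routh_six {a₀ a₁ a₂ a₃ a₄ a₅ a₆ b₁ b₂ c₁ c₂ d₁ e₁ : ℝ}
    (hb₁ : b₁ = a₁ * a₂ - a₀ * a₃) (hb₂ : b₂ = a₁ * a₄ - a₀ * a₅)
    (hc₁ : c₁ = b₁ * a₃ - a₁ * b₂) (hc₂ : c₂ = b₁ * a₅ - a₁ * (a₁ * a₆))
    (hd₁ : d₁ = c₁ * b₂ - b₁ * c₂) (he₁ : e₁ = d₁ * c₂ - c₁ * (c₁ * (a₁ * a₆)))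
    (ha₀p : 0 ≤ a₀) (ha₁p : 0 < a₁) (ha₆p : 0 < a₆) (hb₁p : 0 < b₁) (hc₁p : 0 < c₁)
    (hd₁p : 0 < d₁) (he₁p : 0 < e₁) {s : ℂ} (hs : 0 ≤ s.re) :
    (a₀ : ℂ) * s ^ 6 + a₁ * s ^ 5 + a₂ * s ^ 4 + a₃ * s ^ 3 + a₄ * s ^ 2 + a₅ * s + a₆ ≠ 0 := by
  have h6 : 0 < e₁ * (c₁ * (a₁ * a₆)) := by positivity
  have r5 : RightPair ((e₁ : ℂ) * s) ((e₁ * (c₁ * (a₁ * a₆)) : ℝ) : ℂ) := by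
    refine ⟨?_, fun h ↦ h6.ne' (by exact_mod_cast h.2)⟩
    rw [Complex.conj_ofReal, Complex.re_mul_ofReal, Complex.re_ofReal_mul]
    positivity
  have r4 : RightPair ((d₁ : ℂ) * s ^ 2 + (c₁ * (a₁ * a₆))) ((e₁ : ℂ) * s) :=
    .step he₁p hd₁p.le hs (by push_cast; ring) r5
  have r3 : RightPair ((c₁ : ℂ) * s ^ 3 + c₂ * s) ((d₁ : ℂ) * s ^ 2 + (c₁ * (a₁ * a₆))) :=
    .step hd₁p hc₁p.le hs (by rw [he₁]; push_cast; ring) r4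
  have r2 : RightPair ((b₁ : ℂ) * s ^ 4 + b₂ * s ^ 2 + a₁ * a₆) ((c₁ : ℂ) * s ^ 3 + c₂ * s) :=
    .step hc₁p hb₁p.le hs (by rw [hd₁]; push_cast; ring) r3
  have r1 : RightPair ((a₁ : ℂ) * s ^ 5 + a₃ * s ^ 3 + a₅ * s)
      ((b₁ : ℂ) * s ^ 4 + b₂ * s ^ 2 + a₁ * a₆) :=
    .step hb₁p ha₁p.le hs (by rw [hc₁, hc₂]; push_cast; ring) r2
  have r0 : RightPair ((a₀ : ℂ) * s ^ 6 + a₂ * s ^ 4 + a₄ * s ^ 2 + a₆)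
      ((a₁ : ℂ) * s ^ 5 + a₃ * s ^ 3 + a₅ * s) :=
    .step ha₁p ha₀p hs (by rw [hb₁, hb₂]; push_cast; ring) r1
  intro h
  exact r0.add_ne_zero (by rw [← h]; ring)

/-- The Möbius map `z ↦ 2 / (1 - z) - 1` sends the closed unit disc, without `1`, to the closed
right half-plane. -/
theorem re_two_div_one_sub {z : ℂ} (hz : ‖z‖ ≤ 1) (hz1 : z ≠ 1) : 0 ≤ (2 / (1 - z) - 1).re := by
  have h0 : 1 - z ≠ 0 := sub_ne_zero.2 hz1.symm
  have hN : 0 < Complex.normSq (1 - z) := Complex.normSq_pos.2 h0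
  have h1 : Complex.normSq z ≤ 1 := by
    rw [Complex.normSq_eq_norm_sq]; exact pow_le_one₀ (norm_nonneg _) hz
  have h2 : (2 / (1 - z) - 1).re = (1 - Complex.normSq z) / Complex.normSq (1 - z) := by
    rw [eq_div_iff hN.ne']
    have h3 : (2 / (1 - z)).re * Complex.normSq (1 - z) = 2 * (1 - z).re := by
      rw [Complex.div_re]
      field_simp
      simp
      ring
    rw [Complex.sub_re, sub_mul, h3]
    simp [Complex.normSq_apply]
    ring
  rw [h2]
  exact div_nonneg (by linarith) hN.le

/-- The Routh criterion for the closed unit disc punctured at `1`, applied to a polynomial in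
`1 - z`: with `s = 2 / (1 - z) - 1`, multiplication by `(s + 1) ^ 6` gives a polynomial in `s`, with
the coefficients `a₀, …, a₆`. -/
theorem sum_one_sub_pow_ne_zero {k₀ k₁ k₂ k₃ k₄ k₅ k₆ : ℝ}
    {a₀ a₁ a₂ a₃ a₄ a₅ a₆ b₁ b₂ c₁ c₂ d₁ e₁ : ℝ}
    (ha₀ : a₀ = k₀) (ha₁ : a₁ = 6 * k₀ + 2 * k₁) (ha₂ : a₂ = 15 * k₀ + 10 * k₁ + 4 * k₂)
    (ha₃ : a₃ = 20 * k₀ + 20 * k₁ + 16 * k₂ + 8 * k₃)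
    (ha₄ : a₄ = 15 * k₀ + 20 * k₁ + 24 * k₂ + 24 * k₃ + 16 * k₄)
    (ha₅ : a₅ = 6 * k₀ + 10 * k₁ + 16 * k₂ + 24 * k₃ + 32 * k₄ + 32 * k₅)
    (ha₆ : a₆ = k₀ + 2 * k₁ + 4 * k₂ + 8 * k₃ + 16 * k₄ + 32 * k₅ + 64 * k₆)
    (hb₁ : b₁ = a₁ * a₂ - a₀ * a₃) (hb₂ : b₂ = a₁ * a₄ - a₀ * a₅)
    (hc₁ : c₁ = b₁ * a₃ - a₁ * b₂) (hc₂ : c₂ = b₁ * a₅ - a₁ * (a₁ * a₆))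
    (hd₁ : d₁ = c₁ * b₂ - b₁ * c₂) (he₁ : e₁ = d₁ * c₂ - c₁ * (c₁ * (a₁ * a₆)))
    (ha₀p : 0 ≤ a₀) (ha₁p : 0 < a₁) (ha₆p : 0 < a₆) (hb₁p : 0 < b₁) (hc₁p : 0 < c₁)
    (hd₁p : 0 < d₁) (he₁p : 0 < e₁) {z : ℂ} (hz : ‖z‖ ≤ 1) (hz1 : z ≠ 1) :
    (k₀ : ℂ) + k₁ * (1 - z) + k₂ * (1 - z) ^ 2 + k₃ * (1 - z) ^ 3 + k₄ * (1 - z) ^ 4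
      + k₅ * (1 - z) ^ 5 + k₆ * (1 - z) ^ 6 ≠ 0 := by
  have h0 : 1 - z ≠ 0 := sub_ne_zero.2 hz1.symm
  have key := routh_six hb₁ hb₂ hc₁ hc₂ hd₁ he₁ ha₀p ha₁p ha₆p hb₁p hc₁p hd₁p he₁p
    (re_two_div_one_sub hz hz1)
  set s : ℂ := 2 / (1 - z) - 1 with hs
  have hw : (1 - z) * (s + 1) = 2 := by rw [hs]; field_simp; ring
  intro h
  apply key
  have e : ∀ k : ℕ, (2 : ℂ) ^ k = (1 - z) ^ k * (s + 1) ^ k := fun k ↦ by rw [← mul_pow, hw]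
  have h' : ((k₀ : ℂ) * (s + 1) ^ 6 + k₁ * 2 ^ 1 * (s + 1) ^ 5 + k₂ * 2 ^ 2 * (s + 1) ^ 4
      + k₃ * 2 ^ 3 * (s + 1) ^ 3 + k₄ * 2 ^ 4 * (s + 1) ^ 2 + k₅ * 2 ^ 5 * (s + 1)
      + k₆ * 2 ^ 6) = 0 := by
    simp only [e]
    linear_combination (s + 1) ^ 6 * h
  rw [← h', ha₀, ha₁, ha₂, ha₃, ha₄, ha₅, ha₆]
  push_cast
  ring

namespace SemiImplicit

/-! ### Zeros of the two families of polynomials -/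

/-- The symbol `∑ (1 - z) ^ k / k` of the backward difference formulas of order at most six omits
the negative real axis on the closed unit disc, and vanishes there at most at `z = 1`. -/
theorem bdf_add_ne_zero {p : ℕ} (hp : 1 ≤ p) (hp' : p ≤ 6) {x : ℝ} (hx : 0 ≤ x) {z : ℂ}
    (hz : ‖z‖ ≤ 1) (hz1 : z ≠ 1) :
    (x : ℂ) + ∑ k ∈ Finset.Icc 1 p, (1 / (k : ℂ)) * (1 - z) ^ k ≠ 0 := by
  have key : (x : ℂ) + (1 : ℝ) * (1 - z) + (if 2 ≤ p then 1 / 2 else 0 : ℝ) * (1 - z) ^ 2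
      + (if 3 ≤ p then 1 / 3 else 0 : ℝ) * (1 - z) ^ 3
      + (if 4 ≤ p then 1 / 4 else 0 : ℝ) * (1 - z) ^ 4
      + (if 5 ≤ p then 1 / 5 else 0 : ℝ) * (1 - z) ^ 5
      + (if 6 ≤ p then 1 / 6 else 0 : ℝ) * (1 - z) ^ 6 ≠ 0 := by
    -- All entries of the Routh array are polynomials in `x` with nonnegative coefficients.
    refine sum_one_sub_pow_ne_zero rfl rfl rfl rfl rfl rfl rfl rfl rfl rfl rfl rfl rfl
      hx ?_ ?_ ?_ ?_ ?_ ?_ hz hz1 <;> interval_cases p <;>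
      (try simp only [Nat.reduceLeDiff, le_refl, ↓reduceIte]) <;> ring_nf <;> positivity
  convert key using 1
  interval_cases p <;> norm_num [Finset.sum_Icc_succ_top, add_assoc]

/-- The polynomial factor of the generalized Newton--Gregory formulas of order at most six has no
zero in the closed unit disc. -/
theorem newtonGregory_sum_ne_zero {p : ℕ} (hp : 1 ≤ p) (hp' : p ≤ 6) {α : ℝ} (hα : 0 < α)
    (hα' : α ≤ 1) {z : ℂ} (hz : ‖z‖ ≤ 1) :
    ∑ k ∈ Finset.Icc 1 p, (newtonGregory α (k - 1) : ℂ) * (1 - z) ^ (k - 1) ≠ 0 := by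
  rcases eq_or_ne z 1 with rfl | hz1
  · interval_cases p <;> simp [Finset.sum_Icc_succ_top, newtonGregory]
  have key : ((0 : ℝ) : ℂ) + (1 : ℝ) * (1 - z)
      + (if 2 ≤ p then newtonGregory α 1 else 0 : ℝ) * (1 - z) ^ 2
      + (if 3 ≤ p then newtonGregory α 2 else 0 : ℝ) * (1 - z) ^ 3
      + (if 4 ≤ p then newtonGregory α 3 else 0 : ℝ) * (1 - z) ^ 4
      + (if 5 ≤ p then newtonGregory α 4 else 0 : ℝ) * (1 - z) ^ 5
      + (if 6 ≤ p then newtonGregory α 5 else 0 : ℝ) * (1 - z) ^ 6 ≠ 0 := by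
    -- In order six some entries of the array have negative coefficients at high powers of `α`;
    -- these are absorbed by the linear term because `α ≤ 1`.
    have hpos (k : ℕ) : 0 ≤ α ^ k := pow_nonneg hα.le k
    have hle (k : ℕ) (hk : k ≠ 0) : α ^ k ≤ α := pow_le_of_le_one hα.le hα' hk
    refine sum_one_sub_pow_ne_zero rfl rfl rfl rfl rfl rfl rfl rfl rfl rfl rfl rfl rfl
      le_rfl ?_ ?_ ?_ ?_ ?_ ?_ hz hz1 <;> interval_cases p <;>
      (try simp only [Nat.reduceLeDiff, le_refl, ↓reduceIte, newtonGregory]) <;>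
      ring_nf <;> first
      | positivity
      | linarith [hpos 2, hpos 3, hpos 4, hpos 5, hpos 6, hpos 7, hpos 8, hpos 9,
          hle 6 (by simp), hle 7 (by simp), hle 8 (by simp), hle 9 (by simp), hle 10 (by simp),
          hle 11 (by simp), hle 12 (by simp), hle 13 (by simp), hle 14 (by simp),
          hle 15 (by simp), hle 16 (by simp), hle 17 (by simp), hle 18 (by simp),
          hle 19 (by simp)]
  -- The array was applied to the product with `1 - z`, which fits the same template.
  intro h
  apply key
  have e : ((1 : ℂ) - z) * ∑ k ∈ Finset.Icc 1 p,
      (newtonGregory α (k - 1) : ℂ) * (1 - z) ^ (k - 1) = 0 := by rw [h, mul_zero]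
  rw [← e]
  interval_cases p <;> norm_num [Finset.sum_Icc_succ_top, newtonGregory] <;> ring

end SemiImplicit

/-! ### Wiener's lemma for one-sided sequences -/

/-- **Wiener's lemma** for power series in an operator: if `q` is absolutely summable and its symbol
`∑ q n * z ^ n` has no zero in the closed unit disc, then `∑ q n • T ^ n` is invertible for every
`T` of norm at most one. A character of the closed subalgebra generated by `T` maps `T` into the
closed unit disc, so it cannot vanish on the series. -/
theorem isUnit_tsum_smul_pow {A : Type*} [NormedRing A] [NormedAlgebra ℂ A] [CompleteSpace A]
    (h1 : ‖(1 : A)‖ ≤ 1) {T : A} (hT : ‖T‖ ≤ 1) {q : ℕ → ℂ} (hq : Summable fun n ↦ ‖q n‖)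
    (h0 : ∀ z : ℂ, ‖z‖ ≤ 1 → ∑' n, q n * z ^ n ≠ 0) : IsUnit (∑' n, q n • T ^ n) := by
  let B := Algebra.elemental ℂ T
  let _ : NormedCommRing B := { (inferInstance : NormedRing B) with mul_comm := mul_comm }
  let t : B := ⟨T, Algebra.elemental.self_mem ℂ T⟩
  have hpow (n : ℕ) : ‖t ^ n‖ ≤ 1 := by
    induction n with
    | zero => rw [pow_zero]; exact h1
    | succ n ih =>
      rw [pow_succ]
      exact (norm_mul_le _ _).trans (mul_le_one₀ ih (norm_nonneg _) hT)
  have hs : Summable fun n ↦ q n • t ^ n := by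
    refine Summable.of_norm_bounded hq fun n ↦ ?_
    rw [norm_smul]
    exact mul_le_of_le_one_right (norm_nonneg _) (hpow n)
  have hmap : B.val (∑' n, q n • t ^ n) = ∑' n, q n • T ^ n := by
    have := hs.hasSum.map B.val continuous_subtype_val
    exact this.tsum_eq.symm
  rw [← hmap]
  refine IsUnit.map B.val ?_
  by_contra hu
  obtain ⟨φ, hφ⟩ := WeakDual.CharacterSpace.exists_apply_eq_zero hu
  refine h0 (φ t) ?_ ?_
  · have := spectrum.norm_le_norm_mul_of_mem (AlgHom.apply_mem_spectrum φ t)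
    exact this.trans (mul_le_one₀ hT (norm_nonneg _) h1)
  · have := hs.hasSum.map φ (map_continuous φ)
    rw [hφ] at this
    rw [← this.tsum_eq]
    refine tsum_congr fun n ↦ ?_
    simp

/-- If the symbol of `q` has no zero in the closed unit disc and `S` is a contraction, then the
equation `∑ q k • S ^ k V = f` has a solution `V`; it is stated through the functionals on `E`. -/
theorem exists_hasSum_pow_apply {E : Type*} [NormedAddCommGroup E] [NormedSpace ℂ E]
    [CompleteSpace E] {S : E →L[ℂ] E} (hS : ‖S‖ ≤ 1) {q : ℕ → ℂ} (hq : Summable fun n ↦ ‖q n‖)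
    (h0 : ∀ z : ℂ, ‖z‖ ≤ 1 → ∑' n, q n * z ^ n ≠ 0) (f : E) :
    ∃ V : E, ∀ L : E →L[ℂ] ℂ, HasSum (fun k ↦ q k * L ((S ^ k) V)) (L f) := by
  have hpow (k : ℕ) : ‖S ^ k‖ ≤ 1 := by
    induction k with
    | zero => rw [pow_zero]; exact ContinuousLinearMap.norm_id_le
    | succ k ih =>
      rw [pow_succ]
      exact (norm_mul_le _ _).trans (mul_le_one₀ ih (norm_nonneg _) hS)
  have hs : Summable fun n ↦ q n • S ^ n := by
    refine Summable.of_norm_bounded hq fun n ↦ ?_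
    rw [norm_smul]
    exact mul_le_of_le_one_right (norm_nonneg _) (hpow n)
  obtain ⟨u, hu⟩ := isUnit_tsum_smul_pow ContinuousLinearMap.norm_id_le hS hq h0
  refine ⟨(↑u⁻¹ : E →L[ℂ] E) f, fun L ↦ ?_⟩
  have hV : (∑' n, q n • S ^ n) ((↑u⁻¹ : E →L[ℂ] E) f) = f := by
    rw [← hu]
    change ((u : E →L[ℂ] E) * ↑u⁻¹) f = f
    rw [u.mul_inv]
    rfl
  have := hs.hasSum.map (L.comp (ContinuousLinearMap.apply ℂ E ((↑u⁻¹ : E →L[ℂ] E) f)))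
    (ContinuousLinearMap.continuous _)
  rw [ContinuousLinearMap.comp_apply, ContinuousLinearMap.apply_apply, hV] at this
  refine this.congr_fun fun k ↦ ?_
  simp

/-- The right shift of a null sequence. -/
noncomputable def shiftFun (f : C₀(ℕ, ℂ)) : C₀(ℕ, ℂ) where
  toFun n := n.casesOn 0 f
  continuous_toFun := continuous_of_discreteTopology
  zero_at_infty' := by
    have h := zero_at_infty f
    rw [Filter.cocompact_eq_cofinite, Nat.cofinite_eq_atTop] at h ⊢
    rw [← tendsto_add_atTop_iff_nat 1]
    exact h

/-- The right shift as a contraction of the Banach space of null sequences. -/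
noncomputable def nullShift : C₀(ℕ, ℂ) →L[ℂ] C₀(ℕ, ℂ) :=
  LinearMap.mkContinuous
    { toFun := shiftFun
      map_add' := fun f g ↦ by ext (_ | n) <;> simp [shiftFun]
      map_smul' := fun c f ↦ by ext (_ | n) <;> simp [shiftFun] } 1 <| fun f ↦ by
    rw [one_mul]
    change ‖(shiftFun f).toBCF‖ ≤ ‖f.toBCF‖
    refine (BoundedContinuousFunction.norm_le (norm_nonneg _)).2 ?_
    rintro (_ | n)
    · exact (norm_zero (E := ℂ)).trans_le (norm_nonneg _)
    · exact f.toBCF.norm_coe_le_norm n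

theorem norm_nullShift_le : ‖nullShift‖ ≤ 1 :=
  LinearMap.mkContinuous_norm_le _ zero_le_one _

theorem nullShift_apply_zero (f : C₀(ℕ, ℂ)) : nullShift f 0 = 0 := rfl

theorem nullShift_apply_succ (f : C₀(ℕ, ℂ)) (n : ℕ) : nullShift f (n + 1) = f n := rfl

theorem nullShift_pow_apply (f : C₀(ℕ, ℂ)) (k n : ℕ) :
    (nullShift ^ k) f n = if k ≤ n then f (n - k) else 0 := by
  induction k generalizing n with
  | zero => simp
  | succ k ih =>
    rw [pow_succ']
    cases n with
    | zero => simpa using nullShift_apply_zero _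
    | succ n =>
      change nullShift ((nullShift ^ k) f) (n + 1) = _
      rw [nullShift_apply_succ, ih]
      simp

/-- A causal convolution equation `q * U = f` with a null sequence on the right has a null sequence
as its solution, provided that the symbol of `q` has no zero in the closed unit disc. Inverting the
convolution on null sequences gives one solution that tends to zero, and `q 0 ≠ 0` makes it the
only one. -/
theorem tendsto_zero_of_convolution {q U : ℕ → ℂ} (hq : Summable fun n ↦ ‖q n‖)
    (h0 : ∀ z : ℂ, ‖z‖ ≤ 1 → ∑' n, q n * z ^ n ≠ 0)
    (hU : Tendsto (fun n ↦ ∑ j ∈ Finset.range (n + 1), q (n - j) * U j) atTop (𝓝 0)) :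
    Tendsto U atTop (𝓝 0) := by
  let f : C₀(ℕ, ℂ) :=
    { toFun := fun n ↦ ∑ j ∈ Finset.range (n + 1), q (n - j) * U j
      continuous_toFun := continuous_of_discreteTopology
      zero_at_infty' := by
        rw [Filter.cocompact_eq_cofinite, Nat.cofinite_eq_atTop]
        exact hU }
  obtain ⟨V, hV⟩ := exists_hasSum_pow_apply norm_nullShift_le hq h0 f
  have hconv (n : ℕ) : ∑ j ∈ Finset.range (n + 1), q (n - j) * V j =
      ∑ j ∈ Finset.range (n + 1), q (n - j) * U j := by
    let L : C₀(ℕ, ℂ) →L[ℂ] ℂ :=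
      { toFun := fun g ↦ g n
        map_add' := fun _ _ ↦ rfl
        map_smul' := fun _ _ ↦ rfl
        cont := (continuous_eval_const (F := BoundedContinuousFunction ℕ ℂ) n).comp
          ZeroAtInftyContinuousMap.isometry_toBCF.continuous }
    have h2 : HasSum (fun k ↦ q k * (nullShift ^ k) V n) (f n) := hV L
    have h3 : HasSum (fun k ↦ q k * (nullShift ^ k) V n)
        (∑ k ∈ Finset.range (n + 1), q k * (nullShift ^ k) V n) := by
      refine hasSum_sum_of_ne_finset_zero fun k hk ↦ ?_
      rw [nullShift_pow_apply, if_neg (by simpa using hk), mul_zero]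
    change _ = f n
    rw [h2.unique h3, ← Finset.sum_range_reflect]
    refine Finset.sum_congr rfl fun j hj ↦ ?_
    have hj' : j ≤ n := by simpa [Nat.lt_succ_iff] using hj
    rw [nullShift_pow_apply, if_pos (by omega)]
    congr 2; omega
  have hq0 : q 0 ≠ 0 := by
    have := h0 0 (by simp)
    rwa [tsum_eq_single 0 (fun n hn ↦ by simp [hn]), pow_zero, mul_one] at this
  have hVU (n : ℕ) : V n = U n := by
    induction n using Nat.strong_induction_on with
    | _ n ih =>
      have h := hconv n
      rw [Finset.sum_range_succ, Finset.sum_range_succ, Finset.sum_congr rfl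
        fun j hj ↦ by rw [ih j (Finset.mem_range.1 hj)]] at h
      simpa [hq0] using h
  have hVt := zero_at_infty V
  rw [Filter.cocompact_eq_cofinite, Nat.cofinite_eq_atTop] at hVt
  exact hVt.congr hVU

/-! ### Functions with an absolutely convergent power series on the closed unit disc -/

/-- `f` belongs to the Wiener algebra of the disc: on the closed unit disc it is the sum of a power
series with absolutely summable coefficients. Values of `f` elsewhere play no role. -/
def IsWiener (f : ℂ → ℂ) : Prop :=
  ∃ a : ℕ → ℂ, (Summable fun n ↦ ‖a n‖) ∧ ∀ z : ℂ, ‖z‖ ≤ 1 → HasSum (fun n ↦ a n * z ^ n) (f z)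

theorem summable_norm_mul_pow {a : ℕ → ℂ} (ha : Summable fun n ↦ ‖a n‖) {z : ℂ} (hz : ‖z‖ ≤ 1) :
    Summable fun n ↦ ‖a n * z ^ n‖ := by
  refine Summable.of_nonneg_of_le (fun _ ↦ norm_nonneg _) (fun n ↦ ?_) ha
  rw [norm_mul, norm_pow]
  exact mul_le_of_le_one_right (norm_nonneg _) (pow_le_one₀ (norm_nonneg _) hz)

theorem isWiener_of_finite {f : ℂ → ℂ} (a : ℕ → ℂ) (N : ℕ) (ha : ∀ n, N ≤ n → a n = 0)
    (h : ∀ z, f z = ∑ n ∈ Finset.range N, a n * z ^ n) : IsWiener f := by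
  have hz (n : ℕ) (hn : n ∉ Finset.range N) : a n = 0 := ha n (by simpa using hn)
  refine ⟨a, summable_of_ne_finset_zero (s := Finset.range N) fun n hn ↦ by simp [hz n hn],
    fun z _ ↦ ?_⟩
  rw [h z]
  exact hasSum_sum_of_ne_finset_zero fun n hn ↦ by simp [hz n hn]

theorem isWiener_const (c : ℂ) : IsWiener fun _ ↦ c :=
  isWiener_of_finite (fun n ↦ if n = 0 then c else 0) 1 (fun n hn ↦ by simp; omega) fun z ↦ by simp

theorem isWiener_one_sub : IsWiener fun z ↦ 1 - z :=
  isWiener_of_finite (fun n ↦ if n = 0 then 1 else if n = 1 then -1 else 0) 2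
    (fun n hn ↦ by rw [if_neg (by omega), if_neg (by omega)])
    fun z ↦ by simp [Finset.sum_range_succ, sub_eq_add_neg]

theorem IsWiener.add {f g : ℂ → ℂ} (hf : IsWiener f) (hg : IsWiener g) :
    IsWiener fun z ↦ f z + g z := by
  obtain ⟨a, ha, hfa⟩ := hf
  obtain ⟨b, hb, hgb⟩ := hg
  refine ⟨fun n ↦ a n + b n, (ha.add hb).of_nonneg_of_le (fun _ ↦ norm_nonneg _)
    fun _ ↦ norm_add_le _ _, fun z hz ↦ ?_⟩
  simpa only [add_mul] using (hfa z hz).add (hgb z hz)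

theorem IsWiener.mul {f g : ℂ → ℂ} (hf : IsWiener f) (hg : IsWiener g) :
    IsWiener fun z ↦ f z * g z := by
  obtain ⟨a, ha, hfa⟩ := hf
  obtain ⟨b, hb, hgb⟩ := hg
  refine ⟨fun n ↦ ∑ kl ∈ Finset.HasAntidiagonal.antidiagonal n, a kl.1 * b kl.2,
    summable_norm_sum_mul_antidiagonal_of_summable_norm ha hb, fun z hz ↦ ?_⟩
  have h1 := summable_norm_mul_pow ha hz
  have h2 := summable_norm_mul_pow hb hz
  have h3 := tsum_mul_tsum_eq_tsum_sum_antidiagonal_of_summable_norm h1 h2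
  rw [(hfa z hz).tsum_eq, (hgb z hz).tsum_eq] at h3
  beta_reduce
  rw [h3]
  have h4 := (summable_norm_sum_mul_antidiagonal_of_summable_norm h1 h2).of_norm.hasSum
  refine h4.congr_fun fun n ↦ ?_
  rw [Finset.sum_mul]
  refine Finset.sum_congr rfl fun kl hkl ↦ ?_
  rw [← Finset.HasAntidiagonal.mem_antidiagonal.1 hkl, pow_add]
  ring

theorem IsWiener.pow {f : ℂ → ℂ} (hf : IsWiener f) (k : ℕ) : IsWiener fun z ↦ f z ^ k := by
  induction k with
  | zero => simpa using isWiener_const 1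
  | succ k ih => simpa only [pow_succ] using ih.mul hf

theorem isWiener_sum {ι : Type*} (s : Finset ι) {f : ι → ℂ → ℂ} (hf : ∀ i ∈ s, IsWiener (f i)) :
    IsWiener fun z ↦ ∑ i ∈ s, f i z := by
  classical
  induction s using Finset.induction_on with
  | empty => simpa using isWiener_const 0
  | insert i s hi ih =>
    simp only [Finset.sum_insert hi]
    exact (hf i (by simp)).add (ih fun j hj ↦ hf j (by simp [hj]))

/-- By continuity it is enough to know the power series expansion on the open disc. -/
theorem isWiener_of_ball {f : ℂ → ℂ} {a : ℕ → ℂ} (ha : Summable fun n ↦ ‖a n‖)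
    (hf : ContinuousOn f (Metric.closedBall 0 1))
    (h : ∀ z : ℂ, ‖z‖ < 1 → HasSum (fun n ↦ a n * z ^ n) (f z)) : IsWiener f := by
  refine ⟨a, ha, ?_⟩
  have hc : ContinuousOn (fun z : ℂ ↦ ∑' n, a n * z ^ n) (Metric.closedBall 0 1) := by
    refine continuousOn_tsum (fun n ↦ by fun_prop) ha fun n z hz ↦ ?_
    rw [norm_mul, norm_pow]
    exact mul_le_of_le_one_right (norm_nonneg _) (pow_le_one₀ (norm_nonneg _) (by simpa using hz))
  have heq : Set.EqOn (fun z : ℂ ↦ ∑' n, a n * z ^ n) f (Metric.closedBall 0 1) := by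
    refine Set.EqOn.of_subset_closure (s := Metric.ball 0 1) (fun z hz ↦ ?_) hc hf
      Metric.ball_subset_closedBall (closure_ball (0 : ℂ) one_ne_zero).ge
    exact (h z (by simpa using hz)).tsum_eq
  intro z hz
  rw [← heq (by simpa using hz)]
  exact (summable_norm_mul_pow ha hz).of_norm.hasSum

theorem continuousOn_cpow_of_mem_slitPlane {f : ℂ → ℂ} {s : Set ℂ} {α : ℝ} (hα : 0 < α)
    (hf : ContinuousOn f s) (h : ∀ z ∈ s, f z = 0 ∨ f z ∈ Complex.slitPlane) :
    ContinuousOn (fun z ↦ f z ^ (α : ℂ)) s := by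
  intro z hz
  have hc : ContinuousAt (fun w : ℂ ↦ w ^ (α : ℂ)) (f z) := by
    rcases h z hz with h0 | h0
    · rw [h0]
      have h1 := Complex.continuousAt_cpow_zero_of_re_pos (z := (α : ℂ)) (by simpa using hα)
      exact ContinuousAt.comp (f := fun w : ℂ ↦ (w, (α : ℂ))) h1 (by fun_prop)
    · exact continuousAt_cpow_const h0
  exact ContinuousAt.comp_continuousWithinAt hc (hf z hz)

/-! ### The binomial series with exponent in `(0, 1]` -/

theorem ring_choose_succ (α : ℝ) (n : ℕ) :
    Ring.choose α (n + 1) * (n + 1) = Ring.choose α n * (α - n) := by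
  have h1 := Ring.descPochhammer_eq_factorial_smul_choose α n
  have h2 := Ring.descPochhammer_eq_factorial_smul_choose α (n + 1)
  rw [descPochhammer_succ_right, Polynomial.smeval_mul, h1] at h2
  have h3 : (n.factorial : ℝ) ≠ 0 := by positivity
  apply mul_left_cancel₀ h3
  simp only [Polynomial.smeval_sub, Polynomial.smeval_X, Polynomial.smeval_natCast, pow_one,
    pow_zero, nsmul_eq_mul, mul_one, Nat.factorial_succ, Nat.cast_mul, Nat.cast_succ] at h2
  linear_combination -h2

/-- For `0 < α ≤ 1` all coefficients of `(1 - z) ^ α` but the first are nonpositive, and the partial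
sums of the series at `z = 1` are nonnegative; hence the coefficients are absolutely summable. -/
theorem summable_norm_ring_choose {α : ℝ} (hα : 0 < α) (hα' : α ≤ 1) :
    Summable fun n ↦ ‖Ring.choose α n‖ := by
  set d : ℕ → ℝ := fun n ↦ (-1) ^ n * Ring.choose α n with hd
  have hd0 : d 0 = 1 := by simp [hd]
  have hrec (n : ℕ) : d (n + 1) * (n + 1) = d n * (n - α) := by
    simp only [hd, pow_succ]
    linear_combination -(-1) ^ n * ring_choose_succ α n
  have hneg (n : ℕ) : d (n + 1) ≤ 0 := by
    induction n with
    | zero =>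
      have := hrec 0
      rw [hd0] at this
      norm_num at this
      simpa [this] using hα.le
    | succ n ih =>
      have h1 := hrec (n + 1)
      have h2 : d (n + 1) * ((n + 1 : ℕ) - α) ≤ 0 :=
        mul_nonpos_of_nonpos_of_nonneg ih (by push_cast; linarith [n.cast_nonneg (α := ℝ)])
      have h3 : (0 : ℝ) < (n + 1 : ℕ) + 1 := by positivity
      rw [← h1] at h2
      exact nonpos_of_mul_nonpos_left h2 h3
  have hsum (n : ℕ) : α * ∑ k ∈ Finset.range (n + 1), d k = -((n + 1) * d (n + 1)) := by
    induction n with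
    | zero =>
      have := hrec 0
      rw [hd0] at this
      norm_num at this
      simp [hd0, this]
    | succ n ih =>
      have := hrec (n + 1)
      rw [Finset.sum_range_succ, mul_add, ih]
      push_cast at this ⊢
      linarith
  have hnonneg (n : ℕ) : 0 ≤ ∑ k ∈ Finset.range (n + 1), d k := by
    have h1 : 0 ≤ α * ∑ k ∈ Finset.range (n + 1), d k := by
      rw [hsum]
      have : 0 ≤ (n + 1 : ℝ) := by positivity
      nlinarith [hneg n]
    exact nonneg_of_mul_nonneg_right h1 hα
  have hnorm (n : ℕ) : ‖Ring.choose α n‖ = |d n| := by simp [hd, abs_mul]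
  rw [← summable_nat_add_iff 1]
  refine summable_of_sum_range_le (c := 1) (fun _ ↦ norm_nonneg _) fun n ↦ ?_
  have h1 := hnonneg n
  rw [Finset.sum_range_succ', hd0] at h1
  have h2 : ∑ k ∈ Finset.range n, ‖Ring.choose α (k + 1)‖ = -∑ k ∈ Finset.range n, d (k + 1) := by
    rw [← Finset.sum_neg_distrib]
    exact Finset.sum_congr rfl fun k _ ↦ by rw [hnorm, abs_of_nonpos (hneg k)]
  rw [h2]
  linarith

theorem one_sub_eq_zero_or_mem_slitPlane {z : ℂ} (hz : ‖z‖ ≤ 1) :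
    1 - z = 0 ∨ 1 - z ∈ Complex.slitPlane := by
  rcases eq_or_ne (1 - z) 0 with h | h
  · exact .inl h
  · refine .inr (Complex.mem_slitPlane_iff.2 ?_)
    by_contra! hc
    obtain ⟨h1, h2⟩ := hc
    have h3 := (Complex.re_le_norm z).trans hz
    apply h
    refine Complex.ext ?_ (by simpa using h2)
    simp only [Complex.sub_re, Complex.one_re, Complex.zero_re] at h1 ⊢
    linarith

theorem isWiener_one_sub_mul_cpow {α : ℝ} (hα : 0 < α) (hα' : α ≤ 1) {c : ℂ} (hc : ‖c‖ ≤ 1) :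
    IsWiener fun z ↦ (1 - c * z) ^ (α : ℂ) := by
  have hcz {z : ℂ} (hz : ‖z‖ ≤ 1) : ‖c * z‖ ≤ 1 := by
    rw [norm_mul]; exact mul_le_one₀ hc (norm_nonneg _) hz
  have ha : Summable fun n ↦ ‖((Ring.choose α n : ℝ) : ℂ) * (-c) ^ n‖ :=
    summable_norm_mul_pow (by simpa using summable_norm_ring_choose hα hα') (by simpa using hc)
  refine isWiener_of_ball ha ?_ fun z hz ↦ ?_
  · refine continuousOn_cpow_of_mem_slitPlane hα (by fun_prop) fun z hz ↦ ?_
    exact one_sub_eq_zero_or_mem_slitPlane (hcz (by simpa using hz))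
  · have hlt : ‖-(c * z)‖ < 1 := by
      rw [norm_neg, norm_mul]
      exact (mul_le_of_le_one_left (norm_nonneg _) hc).trans_lt hz
    have := (Complex.one_add_cpow_hasFPowerSeriesOnBall_zero (a := (α : ℂ))).hasSum
      (y := -(c * z)) (by
        rw [← ENNReal.ofReal_one, Metric.eball_ofReal]; simpa using hlt)
    rw [zero_add, ← sub_eq_add_neg] at this
    refine this.congr_fun fun n ↦ ?_
    rw [binomialSeries_apply, List.ofFn_const, List.prod_replicate, smul_eq_mul,
      Complex.ofReal_choose, mul_assoc, ← mul_pow, neg_mul]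

/-! ### Powers of polynomials without zeros in the open disc -/

/-- A product of linear factors `z - r` with all `r` outside the open unit disc has a holomorphic
logarithm `L` there, and `exp (α L)` extends to a function in the Wiener algebra. -/
theorem exists_log_prod_sub {α : ℝ} (hα : 0 < α) (hα' : α ≤ 1) (s : Multiset ℂ)
    (hs : ∀ r ∈ s, 1 ≤ ‖r‖) : ∃ L g : ℂ → ℂ, IsWiener g ∧
      DifferentiableOn ℂ L (Metric.ball 0 1) ∧
      (∀ z ∈ Metric.ball (0 : ℂ) 1, Complex.exp (L z) = (s.map fun r ↦ z - r).prod) ∧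
      ∀ z ∈ Metric.ball (0 : ℂ) 1, g z = Complex.exp (α * L z) := by
  induction s using Multiset.induction_on with
  | empty =>
    exact ⟨fun _ ↦ 0, fun _ ↦ 1, isWiener_const 1, differentiableOn_const 0, by simp, by simp⟩
  | cons r s ih =>
    obtain ⟨L, g, hg, hL, hexp, hgL⟩ := ih fun r hr ↦ hs r (Multiset.mem_cons_of_mem hr)
    have hr : 1 ≤ ‖r‖ := hs r (Multiset.mem_cons_self r s)
    have hr0 : r ≠ 0 := norm_pos_iff.1 (by linarith)
    have hri : ‖r⁻¹‖ ≤ 1 := by rw [norm_inv]; exact inv_le_one_of_one_le₀ hr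
    have hlt {z : ℂ} (hz : z ∈ Metric.ball (0 : ℂ) 1) : 1 - r⁻¹ * z ∈ Complex.slitPlane := by
      have hz' : ‖z‖ < 1 := by simpa using hz
      rw [sub_eq_add_neg]
      refine Complex.mem_slitPlane_of_norm_lt_one ?_
      rw [norm_neg, norm_mul]
      exact (mul_le_of_le_one_left (norm_nonneg _) hri).trans_lt hz'
    refine ⟨fun z ↦ Complex.log (-r) + Complex.log (1 - r⁻¹ * z) + L z,
      fun z ↦ Complex.exp (α * Complex.log (-r)) * (1 - r⁻¹ * z) ^ (α : ℂ) * g z,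
      ((isWiener_const _).mul (isWiener_one_sub_mul_cpow hα hα' hri)).mul hg, ?_, ?_, ?_⟩
    · refine ((differentiableOn_const _).add ?_).add hL
      exact DifferentiableOn.clog (by fun_prop) fun z hz ↦ hlt hz
    · intro z hz
      rw [Complex.exp_add, Complex.exp_add, Complex.exp_log (neg_ne_zero.2 hr0),
        Complex.exp_log (Complex.slitPlane_ne_zero (hlt hz)), hexp z hz, Multiset.map_cons,
        Multiset.prod_cons]
      congr 1
      field_simp
      ring
    · intro z hz
      beta_reduce
      rw [hgL z hz, Complex.cpow_def_of_ne_zero (Complex.slitPlane_ne_zero (hlt hz)),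
        ← Complex.exp_add, ← Complex.exp_add]
      congr 1
      ring

/-- Two holomorphic logarithms of proportional functions on the open unit disc differ by a
constant. -/
theorem exists_eq_add_of_exp_eq {L M : ℂ → ℂ} {c : ℂ}
    (hL : DifferentiableOn ℂ L (Metric.ball 0 1)) (hM : DifferentiableOn ℂ M (Metric.ball 0 1))
    (h : ∀ z ∈ Metric.ball (0 : ℂ) 1, Complex.exp (M z) = c * Complex.exp (L z)) :
    ∃ k : ℂ, ∀ z ∈ Metric.ball (0 : ℂ) 1, M z = k + L z := by
  have hd : DifferentiableOn ℂ (fun z ↦ M z - L z) (Metric.ball 0 1) := hM.sub hL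
  have h0 : Set.EqOn (deriv fun z ↦ M z - L z) 0 (Metric.ball 0 1) := by
    intro z hz
    have hzn := Metric.isOpen_ball.mem_nhds hz
    have h1 := (hd.differentiableAt hzn).hasDerivAt.cexp
    have h2 : HasDerivAt (fun z ↦ Complex.exp (M z - L z)) 0 z := by
      refine (hasDerivAt_const z c).congr_of_eventuallyEq ?_
      filter_upwards [hzn] with w hw
      rw [Complex.exp_sub, h w hw, mul_div_cancel_right₀ _ (Complex.exp_ne_zero _)]
    exact (mul_eq_zero.1 (h1.unique h2)).resolve_left (Complex.exp_ne_zero _)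
  obtain ⟨k, hk⟩ := Metric.isOpen_ball.exists_is_const_of_deriv_eq_zero
    (convex_ball (0 : ℂ) 1).isPreconnected hd h0
  exact ⟨k, fun z hz ↦ by rw [← hk z hz]; ring⟩

/-- If a polynomial takes on the closed unit disc only the value zero and values in the slit plane,
the latter on the whole open disc, then its principal powers with exponent in `(0, 1]` belong to the
Wiener algebra. The polynomial is a product of factors `z - r` with `1 ≤ ‖r‖`, and its principal
power differs from the product of those of the factors by a constant only. -/
theorem isWiener_polynomial_cpow {α : ℝ} (hα : 0 < α) (hα' : α ≤ 1) (P : Polynomial ℂ)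
    (h1 : ∀ z ∈ Metric.closedBall (0 : ℂ) 1, P.eval z = 0 ∨ P.eval z ∈ Complex.slitPlane)
    (h2 : ∀ z ∈ Metric.ball (0 : ℂ) 1, P.eval z ≠ 0) :
    IsWiener fun z ↦ P.eval z ^ (α : ℂ) := by
  have h3 {z : ℂ} (hz : z ∈ Metric.ball (0 : ℂ) 1) : P.eval z ∈ Complex.slitPlane :=
    (h1 z (Metric.ball_subset_closedBall hz)).resolve_left (h2 z hz)
  have hroots : ∀ r ∈ P.roots, 1 ≤ ‖r‖ := by
    intro r hr
    by_contra! hlt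
    exact h2 r (by simpa using hlt) (Polynomial.isRoot_of_mem_roots hr)
  obtain ⟨L, g, ⟨a, ha, hag⟩, hL, hexp, hgL⟩ := exists_log_prod_sub hα hα' P.roots hroots
  have hM : DifferentiableOn ℂ (fun z ↦ Complex.log (P.eval z)) (Metric.ball 0 1) :=
    DifferentiableOn.clog P.differentiable.differentiableOn fun z hz ↦ h3 hz
  obtain ⟨k, hk⟩ := exists_eq_add_of_exp_eq (c := P.leadingCoeff) hL hM fun z hz ↦ by
    rw [Complex.exp_log (h2 z hz), hexp z hz]
    exact (IsAlgClosed.splits P).eval_eq_prod_roots z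
  refine isWiener_of_ball (a := fun n ↦ Complex.exp (α * k) * a n) ?_
    (continuousOn_cpow_of_mem_slitPlane hα P.continuous.continuousOn h1) fun z hz ↦ ?_
  · simpa only [norm_mul] using ha.mul_left _
  · have hz' : z ∈ Metric.ball (0 : ℂ) 1 := by simpa using hz
    have h4 : P.eval z ^ (α : ℂ) = Complex.exp (α * k) * g z := by
      rw [Complex.cpow_def_of_ne_zero (h2 z hz'), hk z hz', hgL z hz', ← Complex.exp_add]
      congr 1
      ring
    rw [h4]
    simpa only [mul_assoc] using (hag z hz.le).mul_left _

/-- The coefficients of a function in the Wiener algebra are its Taylor coefficients at `0`. -/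
theorem IsWiener.taylor {f : ℂ → ℂ} (hf : IsWiener f) :
    (Summable fun n ↦ ‖iteratedDeriv n f 0 / (n.factorial : ℂ)‖) ∧
      ∀ z : ℂ, ‖z‖ ≤ 1 →
        HasSum (fun n ↦ iteratedDeriv n f 0 / (n.factorial : ℂ) * z ^ n) (f z) := by
  obtain ⟨a, ha, h⟩ := hf
  have hps : HasFPowerSeriesOnBall f (FormalMultilinearSeries.ofScalars ℂ a) 0 1 := by
    refine ⟨?_, one_pos, fun {y} hy ↦ ?_⟩
    · refine FormalMultilinearSeries.le_radius_of_summable_norm (r := 1) _ ?_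
      simpa [FormalMultilinearSeries.ofScalars_norm] using ha
    · rw [zero_add]
      have hy' : ‖y‖ < 1 := by
        rw [← ENNReal.ofReal_one, Metric.eball_ofReal] at hy; simpa using hy
      refine (h y hy'.le).congr_fun fun n ↦ ?_
      simp [FormalMultilinearSeries.ofScalars]
  have hcoef (n : ℕ) : iteratedDeriv n f 0 / (n.factorial : ℂ) = a n := by
    rw [div_eq_iff (by exact_mod_cast n.factorial_ne_zero), iteratedDeriv_eq_iteratedFDeriv,
      ← hps.factorial_smul 1 n]
    simp [FormalMultilinearSeries.ofScalars, mul_comm]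
  simp only [hcoef]
  exact ⟨ha, h⟩

namespace SemiImplicit

/-! ### The generating functions -/

theorem genFun_fbdf_one (p : ℕ) (α : ℝ) (z : ℂ) : genFun .fbdf p α 1 z =
    (∑ k ∈ Finset.Icc 1 p, (1 / (k : ℂ)) * (1 - z) ^ k) ^ (α : ℂ) := by
  simp [genFun]

theorem genFun_gngf_one (p : ℕ) (α : ℝ) (z : ℂ) : genFun .gngf p α 1 z =
    (1 - z) ^ (α : ℂ) *
      ∑ k ∈ Finset.Icc 1 p, (newtonGregory α (k - 1) : ℂ) * (1 - z) ^ (k - 1) := by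
  simp [genFun]

theorem bdf_eq_zero_or_mem_slitPlane {p : ℕ} (hp : 1 ≤ p) (hp' : p ≤ 6) {z : ℂ} (hz : ‖z‖ ≤ 1) :
    ∑ k ∈ Finset.Icc 1 p, (1 / (k : ℂ)) * (1 - z) ^ k = 0 ∨
      ∑ k ∈ Finset.Icc 1 p, (1 / (k : ℂ)) * (1 - z) ^ k ∈ Complex.slitPlane := by
  rcases eq_or_ne z 1 with rfl | hz1
  · refine .inl (Finset.sum_eq_zero fun k hk ↦ ?_)
    rw [sub_self, zero_pow (by have := (Finset.mem_Icc.1 hk).1; omega), mul_zero]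
  · refine .inr (Complex.mem_slitPlane_iff.2 ?_)
    by_contra! hc
    refine bdf_add_ne_zero hp hp' (neg_nonneg.2 hc.1) hz hz1 ?_
    apply Complex.ext <;> simp [-one_div, hc.2]

theorem isWiener_genFun (F : Family) {p : ℕ} (hp : 1 ≤ p) (hp' : p ≤ 6) {α : ℝ} (hα : 0 < α)
    (hα' : α ≤ 1) : IsWiener (genFun F p α 1) := by
  cases F with
  | fbdf =>
    rw [funext (genFun_fbdf_one p α)]
    let P : Polynomial ℂ :=
      ∑ k ∈ Finset.Icc 1 p, Polynomial.C (1 / (k : ℂ)) * (1 - Polynomial.X) ^ k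
    have hP (z : ℂ) : P.eval z = ∑ k ∈ Finset.Icc 1 p, (1 / (k : ℂ)) * (1 - z) ^ k := by
      simp [P, Polynomial.eval_finsetSum]
    have := isWiener_polynomial_cpow hα hα' P
      (fun z hz ↦ by rw [hP]; exact bdf_eq_zero_or_mem_slitPlane hp hp' (by simpa using hz))
      (fun z hz ↦ by
        have hz' : ‖z‖ < 1 := by simpa using hz
        rw [hP]
        have h := bdf_add_ne_zero hp hp' le_rfl hz'.le (by rintro rfl; simp at hz')
        simpa only [Complex.ofReal_zero, zero_add] using h)
    simpa only [hP] using this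
  | gngf =>
    rw [funext (genFun_gngf_one p α)]
    have h1 : IsWiener fun z ↦ (1 - z) ^ (α : ℂ) := by
      simpa using isWiener_one_sub_mul_cpow hα hα' (c := 1) (by simp)
    exact h1.mul (isWiener_sum _ fun k _ ↦ (isWiener_const _).mul (isWiener_one_sub.pow _))

theorem genFun_one (F : Family) {p : ℕ} {α : ℝ} (hα : 0 < α) : genFun F p α 1 1 = 0 := by
  have hα0 : (α : ℂ) ≠ 0 := by exact_mod_cast hα.ne'
  cases F with
  | fbdf =>
    rw [genFun_fbdf_one, Finset.sum_eq_zero, Complex.zero_cpow hα0]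
    intro k hk
    rw [sub_self, zero_pow (by have := (Finset.mem_Icc.1 hk).1; omega), mul_zero]
  | gngf => rw [genFun_gngf_one, sub_self, Complex.zero_cpow hα0, zero_mul]

theorem genFun_ne_zero (F : Family) {p : ℕ} (hp : 1 ≤ p) (hp' : p ≤ 6) {α : ℝ} (hα : 0 < α)
    (hα' : α ≤ 1) {z : ℂ} (hz : ‖z‖ ≤ 1) (hz1 : z ≠ 1) : genFun F p α 1 z ≠ 0 := by
  cases F with
  | fbdf =>
    rw [genFun_fbdf_one, Complex.cpow_ne_zero_iff]
    have h := bdf_add_ne_zero hp hp' le_rfl hz hz1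
    exact .inl (by simpa only [Complex.ofReal_zero, zero_add] using h)
  | gngf =>
    rw [genFun_gngf_one]
    refine mul_ne_zero ?_ (newtonGregory_sum_ne_zero hp hp' hα hα' hz)
    exact (Complex.cpow_ne_zero_iff).2 (.inl (sub_ne_zero.2 hz1.symm))

/-! ### The scheme as a convolution equation -/

/-- The Taylor coefficients of the denominator `μ - ν * (1 - z) ^ q`, for `q = 1, 2`. -/
def denomCoeff (μ ν : ℂ) (q : ℕ) : ℕ → ℂ
  | 0 => μ - ν
  | 1 => if q = 1 then ν else 2 * ν
  | 2 => if q = 1 then 0 else -ν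
  | _ => 0

theorem denomCoeff_of_lt (μ ν : ℂ) (q : ℕ) {n : ℕ} (hn : 3 ≤ n) : denomCoeff μ ν q n = 0 := by
  obtain ⟨m, rfl⟩ := Nat.exists_eq_add_of_le' hn
  rfl

theorem hasSum_denomCoeff (μ ν : ℂ) {q : ℕ} (hq : q = 1 ∨ q = 2) (z : ℂ) :
    HasSum (fun n ↦ denomCoeff μ ν q n * z ^ n) (μ - ν * (1 - z) ^ q) := by
  have h : HasSum (fun n ↦ denomCoeff μ ν q n * z ^ n)
      (∑ n ∈ Finset.range 3, denomCoeff μ ν q n * z ^ n) :=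
    hasSum_sum_of_ne_finset_zero fun n hn ↦ by
      rw [denomCoeff_of_lt μ ν q (by simpa using hn), zero_mul]
  convert h using 1
  rcases hq with rfl | rfl <;> simp [Finset.sum_range_succ, denomCoeff] <;> ring

theorem summable_norm_denomCoeff (μ ν : ℂ) (q : ℕ) : Summable fun n ↦ ‖denomCoeff μ ν q n‖ :=
  summable_of_ne_finset_zero (s := Finset.range 3) fun n hn ↦ by
    rw [denomCoeff_of_lt μ ν q (by simpa using hn), norm_zero]

/-- From level `q` on, the right-hand side of the scheme is a convolution. -/
theorem sum_denomCoeff_mul (μ ν : ℂ) {q n : ℕ} (hq : q = 1 ∨ q = 2) (hn : q ≤ n) (U : ℕ → ℂ) :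
    ∑ j ∈ Finset.range (n + 1), denomCoeff μ ν q (n - j) * U j =
      μ * U n - ν * perturbation q n U := by
  rw [← Finset.sum_range_reflect]
  have h1 : ∑ j ∈ Finset.range (n + 1),
      denomCoeff μ ν q (n - (n + 1 - 1 - j)) * U (n + 1 - 1 - j) =
      ∑ j ∈ Finset.range (n + 1), denomCoeff μ ν q j * U (n - j) := by
    refine Finset.sum_congr rfl fun j hj ↦ ?_
    have := Finset.mem_range.1 hj
    congr 2
    omega
  have h2 : ∑ j ∈ Finset.range (n + 1), denomCoeff μ ν q j * U (n - j) =
      ∑ j ∈ Finset.range (q + 1), denomCoeff μ ν q j * U (n - j) := by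
    refine (Finset.sum_subset (Finset.range_mono (by omega)) fun j _ hj ↦ ?_).symm
    have hj' : q < j := by simpa [Nat.lt_succ_iff] using hj
    have : denomCoeff μ ν q j = 0 := by
      rcases lt_or_ge j 3 with h | h
      · obtain rfl : q = 1 := by omega
        obtain rfl : j = 2 := by omega
        simp [denomCoeff]
      · exact denomCoeff_of_lt μ ν q h
    rw [this, zero_mul]
  rw [h1, h2]
  rcases hq with rfl | rfl <;> simp [Finset.sum_range_succ, denomCoeff, perturbation] <;> ring

end SemiImplicit

theorem theorem2p1 (F : SemiImplicit.Family) (p q : ℕ) (hp : 1 ≤ p) (hp' : p ≤ 6)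
    (hq : q = 1 ∨ q = 2) (α : ℝ) (hα : 0 < α) (hα' : α ≤ 1) (lam ρ κ : ℂ) (hlam : lam + ρ ≠ 0)
    (τ : ℝ) (hτ : 0 < τ) (hS : (τ : ℂ) ∈ SemiImplicit.stabilitySet F p q α lam ρ κ) :
    SemiImplicit.IsStable F p q α τ lam ρ κ := by
  intro U hU
  have hT : (τ : ℂ) ^ (α : ℂ) ≠ 0 := Complex.cpow_ne_zero_iff.2 (.inl (by exact_mod_cast hτ.ne'))
  obtain ⟨hsum, hhas⟩ : (Summable fun n ↦ ‖SemiImplicit.weight F p α n‖) ∧ ∀ z : ℂ, ‖z‖ ≤ 1 →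
      HasSum (fun n ↦ SemiImplicit.weight F p α n * z ^ n) (SemiImplicit.genFun F p α 1 z) :=
    (SemiImplicit.isWiener_genFun F hp hp' hα hα').taylor
  set ω := SemiImplicit.weight F p α with hω
  set T := (τ : ℂ) ^ (α : ℂ) with hTdef
  set d := SemiImplicit.denomCoeff (lam + ρ) (ρ + κ) q with hd
  refine tendsto_zero_of_convolution (q := fun n ↦ ω n - T * d n) ?_ (fun z hz ↦ ?_) ?_
  · refine (hsum.add ((SemiImplicit.summable_norm_denomCoeff (lam + ρ) (ρ + κ) q).mul_left
      ‖T‖)).of_nonneg_of_le (fun _ ↦ norm_nonneg _) fun n ↦ ?_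
    exact (norm_sub_le _ _).trans_eq (by rw [norm_mul])
  · have h1 := (hhas z hz).sub
      ((SemiImplicit.hasSum_denomCoeff (lam + ρ) (ρ + κ) hq z).mul_left T)
    have h2 : ∑' n, (ω n - T * d n) * z ^ n =
        SemiImplicit.genFun F p α 1 z - T * ((lam + ρ) - (ρ + κ) * (1 - z) ^ q) := by
      rw [← h1.tsum_eq]
      exact tsum_congr fun n ↦ by ring
    rw [h2]
    by_cases hD : (lam + ρ) - (ρ + κ) * (1 - z) ^ q = 0
    · -- Here the hypothesis on `τ` is void; but `z ≠ 1`, since the denominator at `1` is `lam + ρ`.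
      rw [hD, mul_zero, sub_zero]
      refine SemiImplicit.genFun_ne_zero F hp hp' hα hα' hz ?_
      rintro rfl
      rw [sub_self, zero_pow (by omega), mul_zero, sub_zero] at hD
      exact hlam hD
    · intro h0
      refine hS ⟨z, hz, hD, ?_⟩
      rw [eq_div_iff hD]
      exact (sub_eq_zero.1 h0).symm
  · -- From level `q` on, the convolution is `U 0` times a partial sum of the series of the weights
    -- at `z = 1`, and the sum of that series is zero.
    have h1 : Tendsto (fun n ↦ U 0 * ∑ k ∈ Finset.range (n + 1), ω k) atTop (𝓝 0) := by
      have h := (hhas 1 (by simp)).tendsto_sum_nat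
      rw [SemiImplicit.genFun_one F hα] at h
      simpa using ((tendsto_add_atTop_iff_nat 1).2 h).const_mul (U 0)
    refine h1.congr' ?_
    filter_upwards [eventually_ge_atTop q] with n hn
    have h2 := hU n hn
    rw [← SemiImplicit.sum_denomCoeff_mul _ _ hq hn, ← hω, ← hTdef, ← hd, one_div,
      inv_mul_eq_iff_eq_mul₀ hT] at h2
    have h3 : ∑ j ∈ Finset.range (n + 1), ω (n - j) * (U j - U 0) =
        ∑ j ∈ Finset.range (n + 1), ω (n - j) * U j - U 0 * ∑ k ∈ Finset.range (n + 1), ω k := by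
      rw [← Finset.sum_range_reflect ω, Finset.mul_sum, ← Finset.sum_sub_distrib]
      exact Finset.sum_congr rfl fun j _ ↦ by rw [Nat.add_sub_cancel]; ring
    have h4 : ∑ j ∈ Finset.range (n + 1), (ω (n - j) - T * d (n - j)) * U j =
        ∑ j ∈ Finset.range (n + 1), ω (n - j) * U j
          - T * ∑ j ∈ Finset.range (n + 1), d (n - j) * U j := by
      rw [Finset.mul_sum, ← Finset.sum_sub_distrib]
      exact Finset.sum_congr rfl fun j _ ↦ by ring
    rw [h4, ← h2, h3]
    ring
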